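/- Call two finite groups $L_1$ and $L_2$ \emph{compatible} if there exist a finite group $G$ and normal subgroups $M_1, M_2 \trianglelefteq G$ with $M_1 \cong M_2$ such that $L_1 \cong G/M_1$ and $L_2 \cong G/M_2$. Let $L_1$ and $L_2$ be finite groups of the same order. If there exist normal subgroups $N_1 \trianglelefteq L_1$ and $N_2 \trianglelefteq L_2$ such that $N_1 \cong N_2$ and both $L_1/N_1$ and $L_2/N_2$ are nilpotent, then $L_1$ and $L_2$ are compatible. In particular, any two finite nilpotent groups of the same order are compatible. -/

import Mathlib

/-- Two groups `L₁` and `L₂` are compatible if there is a finite group `G` with isomorphic normal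
subgroups `M₁` and `M₂` such that `L₁ ≅ G / M₁` and `L₂ ≅ G / M₂`. The group `G` is taken in
`Type`, which is no restriction, since every finite group is isomorphic to one there. -/
def GroupsCompatible (L₁ : Type*) (L₂ : Type*) [Group L₁] [Group L₂] : Prop :=
  ∃ (G : Type) (_ : Group G) (_ : Finite G) (M₁ M₂ : Subgroup G) (_ : M₁.Normal) (_ : M₂.Normal),
    Nonempty (M₁ ≃* M₂) ∧ Nonempty (L₁ ≃* G ⧸ M₁) ∧ Nonempty (L₂ ≃* G ⧸ M₂)

/-! A nilpotent quotient of order `n` gives a chain of normal subgroups whose factors have prime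
orders, in any prescribed arrangement of the prime factors of `n`. So `N₁` and `N₂` start chains
climbing to `L₁` and `L₂` with the same primes. Descending the chains from the whole groups, where
there is nothing to do, one finds finite groups mapping onto `L₁` and `L₂` in which the preimages of
corresponding terms are isomorphic. One more descent, from `N₁` and `N₂` to the trivial subgroups,
makes the kernels of the two maps isomorphic.

For the step from `S₁`, `S₂` to subgroups `T₁`, `T₂` of index `p`, cover both groups by one free
group. Since the automorphisms of a free group permute its normal subgroups of index `p`
transitively, passing to suitable finite quotients of the free group makes `S₁` isomorphic to `S₂`
and `T₁` isomorphic to `T₂`. Suppose now that `P` maps to both groups and that `S₁`, `S₂` have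
isomorphic preimages `P₁`, `P₂` in `P`. These become conjugate in the symmetric group on `P`, so in
the semidirect product of `P` with the group coinduced from `S₁ × S₂` along `P → Sym(P)` the
preimages of `P₁` and `P₂` are isomorphic. They are also the preimages of `S₁` and `S₂` under maps
onto the two groups which split over `S₁` and `S₂` as direct products with the kernels `K₁`, `K₂`.
Hence `S₁ × K₁` and `S₂ × K₂` are isomorphic, and after multiplication with `S₁`, so are the
preimages `T₁ × S₁ × K₁` and `T₂ × S₂ × K₂` of `T₁` and `T₂`. -/

universe u

/-! ### Coinduction along the regular representation -/

theorem index_eq_of_nonempty_mulEquiv {G₁ G₂ : Type*} [Group G₁] [Group G₂] [Finite G₁]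
    {N₁ : Subgroup G₁} {N₂ : Subgroup G₂} (hcard : Nat.card G₁ = Nat.card G₂)
    (h : Nonempty (N₁ ≃* N₂)) : N₂.index = N₁.index := by
  obtain ⟨e⟩ := h
  refine Nat.eq_of_mul_eq_mul_left (Nat.card_pos (α := N₁)) ?_
  rw [N₁.card_mul_index, Nat.card_congr e.toEquiv, N₂.card_mul_index, hcard]

theorem exists_perm_semiconjBy_toPermHom {P : Type*} [Group P] [Finite P] {P₁ P₂ : Subgroup P}
    (φ : P₁ ≃* P₂) :
    ∃ t : Equiv.Perm P, ∀ p : P₁,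
      SemiconjBy t (MulAction.toPermHom P P p) (MulAction.toPermHom P P (φ p)) := by
  -- `P₁` acts freely on `P`, and so does `P₂`, which becomes a second action of `P₁` through `φ`;
  -- the numbers of orbits are equal.
  obtain ⟨T₁, hT₁, -⟩ := P₁.exists_isComplement_right 1
  obtain ⟨T₂, hT₂, -⟩ := P₂.exists_isComplement_right 1
  have hindex : P₂.index = P₁.index := index_eq_of_nonempty_mulEquiv rfl ⟨φ⟩
  obtain ⟨e⟩ : Nonempty (T₁ ≃ T₂) :=
    Finite.card_eq.1 (hT₁.card_right.trans (hindex.symm.trans hT₂.card_right.symm))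
  refine ⟨hT₁.equiv.trans ((φ.toEquiv.prodCongr e).trans hT₂.equiv.symm), fun p => ?_⟩
  ext x
  simp [hT₁.equiv_mul_left, hT₂.equiv_symm_apply, mul_assoc]

/-- The group coinduced along `ι : P →* Γ` from a group `A` with an action `α` of `P`: the
functions `u : Γ → A` with `u (γ * ι p) = (α p)⁻¹ (u γ)`, multiplied pointwise. -/
def coind {P Γ A : Type*} [Group P] [Group Γ] [Group A] (ι : P →* Γ) (α : P →* MulAut A) :
    Subgroup (Γ → A) where
  carrier := {u | ∀ γ p, u (γ * ι p) = (α p)⁻¹ (u γ)}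
  one_mem' := fun γ p => by simp
  mul_mem' := fun {u v} hu hv γ p => by simp only [Pi.mul_apply, hu γ p, hv γ p, map_mul]
  inv_mem' := fun {u} hu γ p => by simp only [Pi.inv_apply, hu γ p, map_inv]

/-- For groups `X` and `S` on which `P` acts, the data exhibiting `S` as a `P`-equivariant direct
factor of `X`: an equivariant retraction of `X` onto `S` whose kernel centralizes the copy of `S`
in `X`, the last point being encoded by `conj_incl`. -/
structure EquivariantDirectFactor {P X S : Type*} [Group P] [Group X] [Group S]
    (θ : P →* MulAut X) (β : P →* MulAut S) where
  proj : X →* S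
  incl : S →* X
  proj_incl : ∀ s, proj (incl s) = s
  proj_act : ∀ p x, proj (θ p x) = β p (proj x)
  act_incl : ∀ p s, θ p (incl s) = incl (β p s)
  conj_incl : ∀ x s, x * incl s * x⁻¹ = incl (proj x * s * (proj x)⁻¹)

namespace coind

variable {P Γ A : Type*} [Group P] [Group Γ] [Group A] {ι : P →* Γ} {α : P →* MulAut A}

/-- The action of `Γ` on a group coinduced to `Γ`, by left translation of functions. -/
def act (ι : P →* Γ) (α : P →* MulAut A) : Γ →* MulAut (coind ι α) where
  toFun := fun δ =>
    { toFun := fun u => ⟨fun γ => u.1 (δ⁻¹ * γ), fun γ p => by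
        simpa only [mul_assoc] using u.2 (δ⁻¹ * γ) p⟩
      invFun := fun u => ⟨fun γ => u.1 (δ * γ), fun γ p => by
        simpa only [mul_assoc] using u.2 (δ * γ) p⟩
      left_inv := fun u => by ext; simp
      right_inv := fun u => by ext; simp
      map_mul' := fun u v => rfl }
  map_one' := by ext; simp
  map_mul' := fun δ ε => by ext; simp [mul_assoc]

@[simp]
theorem act_apply (δ : Γ) (u : coind ι α) (γ : Γ) : (act ι α δ u).1 γ = u.1 (δ⁻¹ * γ) := rfl

theorem apply_map (u : coind ι α) (p : P) : u.1 (ι p) = (α p)⁻¹ (u.1 1) := by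
  simpa using u.2 1 p

/-- The functions in the coinduced group that are supported on the range of `ι`, parametrized by
their value at `1`. -/
noncomputable def single (hι : Function.Injective ι) (α : P →* MulAut A) : A →* coind ι α where
  toFun := fun s => ⟨Function.extend ι (fun p => (α p)⁻¹ s) 1, fun γ p => by
    by_cases h : ∃ q, ι q = γ
    · obtain ⟨q, rfl⟩ := h
      rw [← map_mul, hι.extend_apply, hι.extend_apply]
      simp
    · rw [Function.extend_apply' _ _ _ h, Function.extend_apply' _ _ _ fun ⟨q, hq⟩ =>
        h ⟨q * p⁻¹, by simp [hq]⟩]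
      simp⟩
  map_one' := by
    ext γ
    by_cases h : ∃ q, ι q = γ
    · obtain ⟨q, rfl⟩ := h
      simp [hι.extend_apply]
    · simp [Function.extend_apply' _ _ _ h]
  map_mul' := fun s t => by
    ext γ
    by_cases h : ∃ q, ι q = γ
    · obtain ⟨q, rfl⟩ := h
      simp [hι.extend_apply]
    · simp [Function.extend_apply' _ _ _ h]

theorem single_apply_map (hι : Function.Injective ι) (s : A) (p : P) :
    (single hι α s).1 (ι p) = (α p)⁻¹ s :=
  hι.extend_apply (fun p => (α p)⁻¹ s) 1 p

theorem single_apply_of_notMem_range (hι : Function.Injective ι) (s : A) {γ : Γ}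
    (h : γ ∉ Set.range ι) : (single hι α s).1 γ = 1 :=
  Function.extend_apply' (fun p => (α p)⁻¹ s) (1 : Γ → A) γ h

/-- A group with an action of `P` is an equivariant direct factor of its coinduction along an
injective homomorphism. -/
noncomputable def directFactor (hι : Function.Injective ι) (α : P →* MulAut A) :
    EquivariantDirectFactor ((act ι α).comp ι) α where
  proj := (Pi.evalMonoidHom _ 1).comp (coind ι α).subtype
  incl := single hι α
  proj_incl s := by simpa using single_apply_map (α := α) hι s 1
  proj_act p u := by simpa using apply_map u p⁻¹
  act_incl p s := by
    ext γ
    rw [MonoidHom.comp_apply, act_apply]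
    by_cases h : γ ∈ Set.range ι
    · obtain ⟨q, rfl⟩ := h
      rw [← map_inv, ← map_mul, single_apply_map, single_apply_map]
      simp
    · rw [single_apply_of_notMem_range hι _ h, single_apply_of_notMem_range]
      rintro ⟨q, hq⟩
      exact h ⟨p * q, by simp [hq]⟩
  conj_incl u s := by
    ext γ
    change u.1 γ * (single hι α s).1 γ * (u.1 γ)⁻¹ = (single hι α (u.1 1 * s * (u.1 1)⁻¹)).1 γ
    by_cases h : γ ∈ Set.range ι
    · obtain ⟨q, rfl⟩ := h
      rw [single_apply_map, single_apply_map, apply_map]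
      simp
    · rw [single_apply_of_notMem_range hι _ h, single_apply_of_notMem_range hι _ h]
      simp

end coind

/-- The componentwise action of `P` on a product of two groups on which it acts. -/
def prodAct {P A B : Type*} [Group P] [Group A] [Group B] (α : P →* MulAut A) (β : P →* MulAut B) :
    P →* MulAut (A × B) where
  toFun p := (α p).prodCongr (β p)
  map_one' := by rw [map_one, map_one]; rfl
  map_mul' p q := by rw [map_mul, map_mul]; rfl

namespace EquivariantDirectFactor

variable {P X A S : Type*} [Group P] [Group X] [Group A] [Group S] {θ : P →* MulAut X}
  {α : P →* MulAut A} {β : P →* MulAut S}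

/-- The first factor of a product, as an equivariant direct factor. -/
def fst (α : P →* MulAut A) (β : P →* MulAut S) : EquivariantDirectFactor (prodAct α β) α where
  proj := MonoidHom.fst A S
  incl := MonoidHom.inl A S
  proj_incl _ := rfl
  proj_act _ _ := rfl
  act_incl p _ := Prod.ext rfl (map_one (β p))
  conj_incl _ _ := by ext <;> simp

/-- The second factor of a product, as an equivariant direct factor. -/
def snd (α : P →* MulAut A) (β : P →* MulAut S) : EquivariantDirectFactor (prodAct α β) β where
  proj := MonoidHom.snd A S
  incl := MonoidHom.inr A S
  proj_incl _ := rfl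
  proj_act _ _ := rfl
  act_incl p _ := Prod.ext (map_one (α p)) rfl
  conj_incl _ _ := by ext <;> simp

/-- An equivariant direct factor of an equivariant direct factor is again one. -/
def trans (d : EquivariantDirectFactor θ α) (d' : EquivariantDirectFactor α β) :
    EquivariantDirectFactor θ β where
  proj := d'.proj.comp d.proj
  incl := d.incl.comp d'.incl
  proj_incl s := by simp [d.proj_incl, d'.proj_incl]
  proj_act p x := by simp [d.proj_act, d'.proj_act]
  act_incl p s := by simp [d.act_incl, d'.act_incl]
  conj_incl x s := by simp only [MonoidHom.comp_apply, d.conj_incl, d'.conj_incl]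

end EquivariantDirectFactor

theorem nonempty_comap_mulEquiv_prod_ker {G R : Type*} [Group G] [Group R] (g : G →* R)
    {T : Subgroup R} (σ : T →* G) (hσ : g.comp σ = T.subtype)
    (hcomm : ∀ s, ∀ k ∈ g.ker, Commute (σ s) k) : Nonempty (T.comap g ≃* T × g.ker) := by
  let m : T × g.ker →* G := σ.noncommCoprod g.ker.subtype fun s k => hcomm s k k.2
  have hgσ : ∀ s, g (σ s) = s := DFunLike.congr_fun hσ
  have hσinj : Function.Injective σ := fun s s' h => by
    rw [← SetLike.coe_eq_coe, ← hgσ, ← hgσ, h]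
  have hdisj : Disjoint σ.range g.ker := by
    rw [Subgroup.disjoint_def]
    rintro _ ⟨s, rfl⟩ hs
    rw [MonoidHom.mem_ker, hgσ, OneMemClass.coe_eq_one] at hs
    rw [hs, map_one]
  have hm : Function.Injective m := (MonoidHom.noncommCoprod_injective _ _ _).2
    ⟨hσinj, g.ker.subtype_injective, by rwa [Subgroup.range_subtype]⟩
  have hrange : m.range = T.comap g := (MonoidHom.noncommCoprod_range _ _ _).trans <| by
    rw [Subgroup.range_subtype, ← Subgroup.comap_map_eq,
      MonoidHom.map_range, hσ, Subgroup.range_subtype]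
  exact ⟨((MonoidHom.ofInjective hm).trans (MulEquiv.subgroupCongr hrange)).symm⟩

/-- The preimage in `X ⋊ P` of a subgroup `Q` of `P` is `X ⋊ Q`. -/
def comapRightHomEquiv {X P : Type*} [Group X] [Group P] (θ : P →* MulAut X) (Q : Subgroup P) :
    Q.comap (SemidirectProduct.rightHom : X ⋊[θ] P →* P) ≃* X ⋊[θ.comp Q.subtype] Q where
  toFun y := ⟨y.1.left, ⟨y.1.right, y.2⟩⟩
  invFun y := ⟨⟨y.left, y.right⟩, y.right.2⟩
  left_inv _ := rfl
  right_inv _ := rfl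
  map_mul' _ _ := rfl

namespace EquivariantDirectFactor

variable {X P R : Type*} [Group X] [Group P] [Group R] {θ : P →* MulAut X} {f : P →* R}
  {S : Subgroup R} [S.Normal]

/-- A homomorphism `f : P →* R` and an equivariant direct factor `S ⊴ R` of `X` yield a
homomorphism from `X ⋊ P` that projects `X` onto `S` and restricts to `f` on `P`. -/
def toHom (d : EquivariantDirectFactor θ (MulAut.conjNormal.comp f : P →* MulAut S)) :
    X ⋊[θ] P →* R :=
  SemidirectProduct.lift (S.subtype.comp d.proj) f fun p => by
    ext x
    simp [d.proj_act]

variable (d : EquivariantDirectFactor θ (MulAut.conjNormal.comp f : P →* MulAut S))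

theorem toHom_apply (y : X ⋊[θ] P) : d.toHom y = d.proj y.left * f y.right := rfl

theorem toHom_surjective (h : S ⊔ f.range = ⊤) : Function.Surjective d.toHom := by
  intro r
  obtain ⟨s, hs, _, ⟨p, rfl⟩, rfl⟩ := Subgroup.mem_sup_of_normal_left.1 (h ▸ Subgroup.mem_top r)
  exact ⟨⟨d.incl ⟨s, hs⟩, p⟩, by rw [toHom_apply, d.proj_incl]⟩

theorem comap_toHom : S.comap d.toHom = (S.comap f).comap SemidirectProduct.rightHom := by
  ext y
  exact Subgroup.mul_mem_cancel_left S (d.proj y.left).2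

theorem nonempty_comap_toHom_mulEquiv {T : Subgroup R} (hT : T ≤ S) :
    Nonempty (T.comap d.toHom ≃* T × d.toHom.ker) := by
  refine nonempty_comap_mulEquiv_prod_ker d.toHom
    ((SemidirectProduct.inl.comp d.incl).comp (Subgroup.inclusion hT)) ?_ fun s k hk => ?_
  · ext s
    simp [toHom_apply, d.proj_incl]
  · have hproj : (d.proj k.left : R) = (f k.right)⁻¹ := eq_inv_of_mul_eq_one_left hk
    have hconj : k * SemidirectProduct.inl (d.incl (Subgroup.inclusion hT s)) * k⁻¹ =
        SemidirectProduct.inl (k.left * θ k.right (d.incl (Subgroup.inclusion hT s)) *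
          k.left⁻¹) := by
      ext <;> simp
    rw [d.act_incl, d.conj_incl] at hconj
    refine (mul_inv_eq_iff_eq_mul.1 (hconj.trans ?_)).symm
    simp only [MonoidHom.comp_apply]
    congr 2
    ext
    simp [hproj, mul_assoc]

end EquivariantDirectFactor

theorem exists_surjective_nonempty_comap_mulEquiv_prod_ker {P R₁ R₂ : Type u} [Group P]
    [Group R₁] [Group R₂] [Finite P] [Finite R₁] [Finite R₂] {f₁ : P →* R₁} {f₂ : P →* R₂}
    {S₁ : Subgroup R₁} {S₂ : Subgroup R₂} [S₁.Normal] [S₂.Normal] (h₁ : S₁ ⊔ f₁.range = ⊤)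
    (h₂ : S₂ ⊔ f₂.range = ⊤) (φ : S₁.comap f₁ ≃* S₂.comap f₂) :
    ∃ (G : Type u) (_ : Group G) (_ : Finite G) (g₁ : G →* R₁) (g₂ : G →* R₂),
      Function.Surjective g₁ ∧ Function.Surjective g₂ ∧
      Nonempty (S₁.comap g₁ ≃* S₂.comap g₂) ∧
      (∀ T ≤ S₁, Nonempty (T.comap g₁ ≃* T × g₁.ker)) ∧
      ∀ T ≤ S₂, Nonempty (T.comap g₂ ≃* T × g₂.ker) := by
  let ι := MulAction.toPermHom P P
  have hι : Function.Injective ι := MulAction.toPerm_injective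
  obtain ⟨t, ht⟩ := exists_perm_semiconjBy_toPermHom φ
  let α := prodAct (MulAut.conjNormal.comp f₁ : P →* MulAut S₁)
    (MulAut.conjNormal.comp f₂ : P →* MulAut S₂)
  let θ : P →* MulAut (coind ι α) := (coind.act ι α).comp ι
  let d₁ := (coind.directFactor hι α).trans (.fst _ _)
  let d₂ := (coind.directFactor hι α).trans (.snd _ _)
  have hcomap : Nonempty (S₁.comap d₁.toHom ≃* S₂.comap d₂.toHom) := by
    rw [d₁.comap_toHom, d₂.comap_toHom]
    refine ⟨(comapRightHomEquiv θ _).trans ((SemidirectProduct.congr (coind.act ι α t) φ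
      fun p => MulEquiv.ext fun x => ?_).trans (comapRightHomEquiv θ _).symm)⟩
    exact DFunLike.congr_fun ((ht p).map (coind.act ι α)).eq x
  have : Finite (coind ι α ⋊[θ] P) := Finite.of_equiv _ SemidirectProduct.equivProd.symm
  exact ⟨_, _, this, d₁.toHom, d₂.toHom, d₁.toHom_surjective h₁, d₂.toHom_surjective h₂, hcomap,
    fun _ => d₁.nonempty_comap_toHom_mulEquiv, fun _ => d₂.nonempty_comap_toHom_mulEquiv⟩

theorem exists_surjective_nonempty_comap_mulEquiv {P R₁ R₂ : Type u} [Group P]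
    [Group R₁] [Group R₂] [Finite P] [Finite R₁] [Finite R₂] {f₁ : P →* R₁} {f₂ : P →* R₂}
    {S₁ T₁ : Subgroup R₁} {S₂ T₂ : Subgroup R₂} [S₁.Normal] [S₂.Normal] (h₁ : S₁ ⊔ f₁.range = ⊤)
    (h₂ : S₂ ⊔ f₂.range = ⊤) (φ : S₁.comap f₁ ≃* S₂.comap f₂) (hT₁ : T₁ ≤ S₁) (hT₂ : T₂ ≤ S₂)
    (eS : S₁ ≃* S₂) (eT : T₁ ≃* T₂) :
    ∃ (G : Type u) (_ : Group G) (_ : Finite G) (g₁ : G →* R₁) (g₂ : G →* R₂),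
      Function.Surjective g₁ ∧ Function.Surjective g₂ ∧
      Nonempty (T₁.comap g₁ ≃* T₂.comap g₂) := by
  obtain ⟨G, _, _, g₁, g₂, hg₁, hg₂, ⟨e⟩, hprod₁, hprod₂⟩ :=
    exists_surjective_nonempty_comap_mulEquiv_prod_ker h₁ h₂ φ
  obtain ⟨a₁⟩ := hprod₁ S₁ le_rfl
  obtain ⟨a₂⟩ := hprod₂ S₂ le_rfl
  obtain ⟨b₁⟩ := hprod₁ T₁ hT₁
  obtain ⟨b₂⟩ := hprod₂ T₂ hT₂
  -- The factor `S₁` avoids cancelling `S₁ ≃* S₂` from `S₁ × g₁.ker ≃* S₂ × g₂.ker`.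
  refine ⟨G × S₁, inferInstance, inferInstance, g₁.comp (.fst _ _), g₂.comp (.fst _ _),
    hg₁.comp Prod.fst_surjective, hg₂.comp Prod.fst_surjective, ?_⟩
  rw [← Subgroup.comap_comap, ← Subgroup.comap_comap, ← Subgroup.prod_top, ← Subgroup.prod_top]
  let r {A B C : Type u} [Group A] [Group B] [Group C] : (A × B) × C ≃* A × (C × B) :=
    MulEquiv.prodAssoc.trans (.prodCongr (.refl A) .prodComm)
  let c₁ : (T₁.comap g₁).prod (⊤ : Subgroup S₁) ≃* T₁ × (S₁ × g₁.ker) :=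
    (Subgroup.prodEquiv _ _).trans ((b₁.prodCongr Subgroup.topEquiv).trans r)
  let c₂ : (T₂.comap g₂).prod (⊤ : Subgroup S₁) ≃* T₂ × (S₂ × g₂.ker) :=
    (Subgroup.prodEquiv _ _).trans ((b₂.prodCongr (Subgroup.topEquiv.trans eS)).trans r)
  exact ⟨c₁.trans ((eT.prodCongr ((a₁.symm.trans e).trans a₂)).trans c₂.symm)⟩

/-! ### Normal subgroups of prime index in free groups -/

section FreeGroup

variable {ι F : Type*} [Group F]

/-- The automorphism of a free group that multiplies each basis element by a power of one of
them, the `j`-th, which is fixed. -/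
noncomputable def basisTransvection (b : FreeGroupBasis ι F) (j : ι) (k : ι → ℤ) (hk : k j = 0) :
    F ≃* F :=
  MonoidHom.toMulEquiv (b.lift fun i => b i * b j ^ k i) (b.lift fun i => b i * b j ^ (-k i))
    (b.ext_hom _ _ fun i => by simp [hk]) (b.ext_hom _ _ fun i => by simp [hk])

theorem basisTransvection_apply_basis (b : FreeGroupBasis ι F) (j : ι) (k : ι → ℤ) (hk : k j = 0)
    (i : ι) : basisTransvection b j k hk (b i) = b i * b j ^ k i := by
  simp [basisTransvection]

theorem exists_mulEquiv_apply_basis_eq_one (b : FreeGroupBasis ι F) {C : Type*} [Group C]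
    {p : ℕ} (hp : p.Prime) (hC : Nat.card C = p) {q : F →* C} (hq : q ≠ 1) (j : ι) :
    ∃ ε : F ≃* F, q (ε (b j)) ≠ 1 ∧ ∀ i ≠ j, q (ε (b i)) = 1 := by
  classical
  have : Fact p.Prime := ⟨hp⟩
  obtain ⟨l, hl⟩ : ∃ l, q (b l) ≠ 1 := by
    contrapose! hq
    exact b.ext_hom _ _ hq
  let swap : F ≃* F := (b.reindex (Equiv.swap j l)).repr.trans b.repr.symm
  have hswap : ∀ i, swap (b i) = b (Equiv.swap j l i) := fun i => by
    have hrepr := (b.reindex (Equiv.swap j l)).repr_apply_coe (Equiv.swap j l i)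
    rw [FreeGroupBasis.reindex_apply, Equiv.symm_apply_apply] at hrepr
    exact congrArg b.repr.symm hrepr
  have hpow : ∀ i, ∃ k : ℤ, q (b l) ^ k = q (swap (b i)) := fun _ =>
    Subgroup.mem_zpowers_iff.1 (mem_zpowers_of_prime_card hC hl)
  choose k hk using hpow
  refine ⟨(basisTransvection b j (fun i => if i = j then 0 else -k i) (if_pos rfl)).trans swap,
    ?_, fun i hi => ?_⟩
  · simpa [basisTransvection_apply_basis, hswap] using hl
  · have hj : swap (b j) = b l := by simp [hswap]
    simp [basisTransvection_apply_basis, hi, hj, hk]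

theorem exists_mulEquiv_comap_ker_eq_ker [IsFreeGroup F] {p : ℕ} (hp : p.Prime) {C₁ C₂ : Type*}
    [Group C₁] [Group C₂] (h₁ : Nat.card C₁ = p) (h₂ : Nat.card C₂ = p) {q₁ : F →* C₁}
    {q₂ : F →* C₂} (hq₁ : q₁ ≠ 1) (hq₂ : q₂ ≠ 1) :
    ∃ ε : F ≃* F, q₂.ker.comap (ε : F →* F) = q₁.ker := by
  have : Fact p.Prime := ⟨hp⟩
  let b := IsFreeGroup.basis F
  obtain ⟨j⟩ : Nonempty (IsFreeGroup.Generators F) := by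
    by_contra! h
    exact hq₁ (b.ext_hom _ _ isEmptyElim)
  obtain ⟨ε₁, hj₁, hne₁⟩ := exists_mulEquiv_apply_basis_eq_one b hp h₁ hq₁ j
  obtain ⟨ε₂, hj₂, hne₂⟩ := exists_mulEquiv_apply_basis_eq_one b hp h₂ hq₂ j
  have hgen₁ : ∀ c, c ∈ Subgroup.zpowers (q₁ (ε₁ (b j))) := fun _ =>
    mem_zpowers_of_prime_card h₁ hj₁
  have hgen₂ : ∀ c, c ∈ Subgroup.zpowers (q₂ (ε₂ (b j))) := fun _ =>
    mem_zpowers_of_prime_card h₂ hj₂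
  let e : C₁ ≃* C₂ := mulEquivOfOrderOfEq hgen₁ hgen₂ <| by
    rw [orderOf_eq_card_of_forall_mem_zpowers hgen₁, orderOf_eq_card_of_forall_mem_zpowers hgen₂,
      h₁, h₂]
  have he : ((e : C₁ →* C₂).comp q₁).comp (ε₁ : F →* F) = q₂.comp (ε₂ : F →* F) := by
    refine b.ext_hom _ _ fun i => ?_
    change e (q₁ (ε₁ (b i))) = q₂ (ε₂ (b i))
    by_cases hi : i = j
    · rw [hi, mulEquivOfOrderOfEq_apply_gen]
    · rw [hne₁ i hi, hne₂ i hi, map_one]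
  refine ⟨ε₁.symm.trans ε₂, ?_⟩
  ext x
  have hx : e (q₁ (ε₁ (ε₁.symm x))) = q₂ (ε₂ (ε₁.symm x)) := DFunLike.congr_fun he _
  rw [ε₁.apply_symm_apply] at hx
  change q₂ (ε₂ (ε₁.symm x)) = 1 ↔ q₁ x = 1
  rw [← hx, e.map_eq_one_iff]

theorem exists_mulEquiv_comap_eq [IsFreeGroup F] {p : ℕ} (hp : p.Prime) {T₁ T₂ : Subgroup F}
    [T₁.Normal] [T₂.Normal] (h₁ : T₁.index = p) (h₂ : T₂.index = p) :
    ∃ ε : F ≃* F, T₂.comap (ε : F →* F) = T₁ := by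
  have hmk : ∀ (T : Subgroup F) [T.Normal], T.index = p → QuotientGroup.mk' T ≠ 1 :=
    fun T _ hT h => hp.ne_one <| by
      rw [← hT, ← QuotientGroup.ker_mk' T, h, MonoidHom.ker_one, Subgroup.index_top]
  obtain ⟨ε, hε⟩ := exists_mulEquiv_comap_ker_eq_ker hp h₁ h₂ (hmk T₁ h₁) (hmk T₂ h₂)
  exact ⟨ε, by simpa only [QuotientGroup.ker_mk'] using hε⟩

end FreeGroup

/-! ### Normal series with prime factors -/

/-- `HasPrimeNormalSeries l T` says that the group has a chain of normal subgroups climbing from `T`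
to the whole group, whose factors have prime orders, listed by `l` from the bottom to the top. -/
inductive HasPrimeNormalSeries {G : Type*} [Group G] : List ℕ → Subgroup G → Prop
  | nil : HasPrimeNormalSeries [] ⊤
  | cons {p : ℕ} {l : List ℕ} {T S : Subgroup G} (hp : p.Prime) (hT : T.Normal) (hTS : T ≤ S)
      (hindex : T.relIndex S = p) (hS : HasPrimeNormalSeries l S) : HasPrimeNormalSeries (p :: l) T

theorem relIndex_comap_comap {G G' : Type*} [Group G] [Group G'] {f : G' →* G}
    (hf : Function.Surjective f) (T S : Subgroup G) :
    (T.comap f).relIndex (S.comap f) = T.relIndex S := by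
  rw [Subgroup.relIndex_comap, Subgroup.map_comap_eq_self_of_surjective hf]

namespace HasPrimeNormalSeries

variable {G : Type*} [Group G] {l : List ℕ}

theorem normal {T : Subgroup G} : HasPrimeNormalSeries l T → T.Normal
  | nil => inferInstance
  | cons _ hT _ _ _ => hT

theorem comap {G' : Type*} [Group G'] {f : G' →* G} (hf : Function.Surjective f)
    {T : Subgroup G} (h : HasPrimeNormalSeries l T) : HasPrimeNormalSeries l (T.comap f) := by
  induction h with
  | nil => exact nil
  | cons hp _ hTS hindex _ ih =>
    exact cons hp inferInstance (Subgroup.comap_mono hTS)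
      ((relIndex_comap_comap hf _ _).trans hindex) ih

end HasPrimeNormalSeries

theorem exists_mulEquiv_comap_subgroupOf_eq {G₁ G₂ : Type*} [Group G₁] [Group G₂]
    {S₁ T₁ : Subgroup G₁} {S₂ T₂ : Subgroup G₂} [IsFreeGroup S₁] [T₁.Normal] [T₂.Normal]
    {p : ℕ} (hp : p.Prime) (h₁ : T₁.relIndex S₁ = p) (h₂ : T₂.relIndex S₂ = p) (e : S₁ ≃* S₂) :
    ∃ e' : S₁ ≃* S₂, (T₂.subgroupOf S₂).comap (e' : S₁ →* S₂) = T₁.subgroupOf S₁ := by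
  have h₂' : ((T₂.subgroupOf S₂).comap (e : S₁ →* S₂)).index = p :=
    (Subgroup.index_comap_of_surjective _ e.surjective).trans h₂
  obtain ⟨ε, hε⟩ := exists_mulEquiv_comap_eq hp h₁ h₂'
  exact ⟨ε.trans e, hε⟩

theorem exists_mulEquiv_coe_eq {G₁ G₂ : Type*} [Group G₁] [Group G₂] {S₁ T₁ : Subgroup G₁}
    {S₂ T₂ : Subgroup G₂} (hT₁ : T₁ ≤ S₁) (hT₂ : T₂ ≤ S₂) {e : S₁ ≃* S₂}
    (he : (T₂.subgroupOf S₂).comap (e : S₁ →* S₂) = T₁.subgroupOf S₁) :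
    ∃ e' : T₁ ≃* T₂, ∀ x, (e' x : G₂) = e (Subgroup.inclusion hT₁ x) := by
  have hmap : (T₁.subgroupOf S₁).map (e : S₁ →* S₂) = T₂.subgroupOf S₂ := by
    rw [← he, Subgroup.map_comap_eq_self_of_surjective e.surjective]
  exact ⟨((Subgroup.subgroupOfEquivOfLe hT₁).symm.trans ((e.subgroupMap _).trans
    (MulEquiv.subgroupCongr hmap))).trans (Subgroup.subgroupOfEquivOfLe hT₂), fun _ => rfl⟩

theorem HasPrimeNormalSeries.nonempty_mulEquiv {F : Type*} [Group F] [IsFreeGroup F] {l : List ℕ}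
    {U₁ U₂ : Subgroup F} (h₁ : HasPrimeNormalSeries l U₁) (h₂ : HasPrimeNormalSeries l U₂) :
    Nonempty (U₁ ≃* U₂) := by
  induction h₁ generalizing U₂ with
  | nil =>
    cases h₂
    exact ⟨.refl _⟩
  | cons hp hT₁ hTS₁ hindex₁ _ ih =>
    cases h₂ with
    | cons _ hT₂ hTS₂ hindex₂ h₂ =>
      obtain ⟨e⟩ := ih h₂
      obtain ⟨_, he⟩ := exists_mulEquiv_comap_subgroupOf_eq hp hindex₁ hindex₂ e
      obtain ⟨e', -⟩ := exists_mulEquiv_coe_eq hTS₁ hTS₂ he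
      exact ⟨e'⟩

/-- The intersection of the kernels of all homomorphisms from `S` to `H`: a characteristic
subgroup of `S` which, being defined without reference to a presentation, is preserved by every
isomorphism of `S` with another group. -/
def commonKernel (S H : Type*) [Group S] [Group H] : Subgroup S := ⨅ χ : S →* H, χ.ker

section CommonKernel

variable {S S' H : Type*} [Group S] [Group S'] [Group H]

theorem mem_commonKernel {x : S} : x ∈ commonKernel S H ↔ ∀ χ : S →* H, χ x = 1 := by
  simp only [commonKernel, Subgroup.mem_iInf, MonoidHom.mem_ker]

theorem apply_mem_commonKernel_iff (e : S ≃* S') {x : S} :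
    e x ∈ commonKernel S' H ↔ x ∈ commonKernel S H := by
  rw [mem_commonKernel, mem_commonKernel]
  exact ⟨fun h χ => by simpa using h (χ.comp (e.symm : S' →* S)),
    fun h χ => h (χ.comp (e : S →* S'))⟩

instance commonKernel_characteristic : (commonKernel S H).Characteristic :=
  ⟨fun e => by ext x; exact apply_mem_commonKernel_iff e⟩

theorem finite_monoidHom_of_fg [Group.FG S] [Finite H] : Finite (S →* H) := by
  obtain ⟨X, hX⟩ := (Group.fg_def (G := S)).1 inferInstance
  refine Finite.of_injective (fun χ (x : X) => χ x) fun χ χ' h => ?_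
  exact MonoidHom.eq_of_eqOn_dense hX fun x hx => congrFun h ⟨x, hx⟩

instance commonKernel_finiteIndex [Group.FG S] [Finite H] : (commonKernel S H).FiniteIndex :=
  have : Finite (S →* H) := finite_monoidHom_of_fg
  Subgroup.finiteIndex_iInf fun _ => inferInstance

end CommonKernel

theorem exists_finite_quotient_ker_eq_commonKernel {F R H : Type*} [Group F] [Group R] [Group H]
    [Group.FG F] [Finite R] [Finite H] {ψ : F →* R} (hψ : Function.Surjective ψ) {j : R →* H}
    (hj : Function.Injective j) (S : Subgroup R) [S.Normal] :
    ∃ (N : Subgroup F) (_ : N.Normal) (_ : Finite (F ⧸ N)) (π : F ⧸ N →* R),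
      Function.Surjective π ∧ π.comp (QuotientGroup.mk' N) = ψ ∧
      ∀ x : S.comap ψ, (x : F) ∈ N ↔ x ∈ commonKernel (S.comap ψ) H := by
  have : (S.comap ψ).FiniteIndex :=
    ⟨by rw [Subgroup.index_comap_of_surjective S hψ]; exact Subgroup.index_ne_zero_of_finite⟩
  let N := (commonKernel (S.comap ψ) H).map (S.comap ψ).subtype
  have : N.FiniteIndex := ⟨by
    rw [Subgroup.index_map_subtype]
    exact mul_ne_zero Subgroup.FiniteIndex.index_ne_zero Subgroup.FiniteIndex.index_ne_zero⟩
  have hN : N ≤ ψ.ker := by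
    rintro _ ⟨x, hx, rfl⟩
    have hjx := mem_commonKernel.1 hx ((j.comp ψ).comp (S.comap ψ).subtype)
    exact hj (hjx.trans (map_one j).symm)
  exact ⟨N, inferInstance, inferInstance, QuotientGroup.lift N ψ hN,
    QuotientGroup.lift_surjective_of_surjective N ψ hψ hN, rfl,
    fun _ => Subgroup.mem_map_iff_mem (Subgroup.subtype_injective _)⟩

theorem nonempty_map_mulEquiv_map {G₁ G₂ H₁ H₂ : Type*} [Group G₁] [Group G₂] [Group H₁]
    [Group H₂] {W₁ : Subgroup G₁} {W₂ : Subgroup G₂} {f₁ : G₁ →* H₁} {f₂ : G₂ →* H₂}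
    (e : W₁ ≃* W₂) (h : ∀ x : W₁, f₁ x = 1 ↔ f₂ (e x) = 1) :
    Nonempty (W₁.map f₁ ≃* W₂.map f₂) := by
  let q₁ := f₁.subgroupMap W₁
  let q₂ := (f₂.subgroupMap W₂).comp (e : W₁ →* W₂)
  have hq₁ : Function.Surjective q₁ := f₁.subgroupMap_surjective W₁
  have hq₂ : Function.Surjective q₂ := (f₂.subgroupMap_surjective W₂).comp e.surjective
  have hker : q₁.ker = q₂.ker := by
    ext x
    rw [MonoidHom.mem_ker, MonoidHom.mem_ker, Subtype.ext_iff, Subtype.ext_iff]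
    exact h x
  exact ⟨(QuotientGroup.quotientKerEquivOfSurjective q₁ hq₁).symm.trans
    ((QuotientGroup.quotientMulEquivOfEq hker).trans
      (QuotientGroup.quotientKerEquivOfSurjective q₂ hq₂))⟩

theorem exists_finite_covers_nonempty_comap_mulEquiv {R₁ R₂ : Type u} [Group R₁] [Group R₂]
    [Finite R₁] [Finite R₂] {S₁ T₁ : Subgroup R₁} {S₂ T₂ : Subgroup R₂} [T₁.Normal] [T₂.Normal]
    (hT₁ : T₁ ≤ S₁) (hT₂ : T₂ ≤ S₂) {p : ℕ} (hp : p.Prime) (h₁ : T₁.relIndex S₁ = p)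
    (h₂ : T₂.relIndex S₂ = p) {l : List ℕ} (hS₁ : HasPrimeNormalSeries l S₁)
    (hS₂ : HasPrimeNormalSeries l S₂) :
    ∃ (R₁' R₂' : Type u) (_ : Group R₁') (_ : Group R₂') (_ : Finite R₁') (_ : Finite R₂')
      (π₁ : R₁' →* R₁) (π₂ : R₂' →* R₂), Function.Surjective π₁ ∧ Function.Surjective π₂ ∧
      Nonempty (S₁.comap π₁ ≃* S₂.comap π₂) ∧ Nonempty (T₁.comap π₁ ≃* T₂.comap π₂) := by
  have := hS₁.normal
  have := hS₂.normal
  let ψ₁ : FreeGroup (R₁ × R₂) →* R₁ := FreeGroup.lift Prod.fst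
  let ψ₂ : FreeGroup (R₁ × R₂) →* R₂ := FreeGroup.lift Prod.snd
  have hψ₁ : Function.Surjective ψ₁ := fun r => ⟨FreeGroup.of (r, 1), by simp [ψ₁]⟩
  have hψ₂ : Function.Surjective ψ₂ := fun r => ⟨FreeGroup.of (1, r), by simp [ψ₂]⟩
  obtain ⟨e₀⟩ := (hS₁.comap hψ₁).nonempty_mulEquiv (hS₂.comap hψ₂)
  obtain ⟨e, he⟩ := exists_mulEquiv_comap_subgroupOf_eq hp
    ((relIndex_comap_comap hψ₁ T₁ S₁).trans h₁)
    ((relIndex_comap_comap hψ₂ T₂ S₂).trans h₂) e₀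
  obtain ⟨e', he'⟩ := exists_mulEquiv_coe_eq (Subgroup.comap_mono hT₁) (Subgroup.comap_mono hT₂) he
  -- Both `R₁` and `R₂` embed in `R₁ × R₂`, so that one and the same characteristic subgroup of
  -- `S₁.comap ψ₁ ≃* S₂.comap ψ₂` lies in the kernels of `ψ₁` and `ψ₂`.
  obtain ⟨N₁, _, _, π₁, hπ₁, hπψ₁, hN₁⟩ := exists_finite_quotient_ker_eq_commonKernel hψ₁
    (j := MonoidHom.inl R₁ R₂) (Prod.mk_left_injective 1) S₁
  obtain ⟨N₂, _, _, π₂, hπ₂, hπψ₂, hN₂⟩ := exists_finite_quotient_ker_eq_commonKernel hψ₂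
    (j := MonoidHom.inr R₁ R₂) (Prod.mk_right_injective 1) S₂
  have hmk : ∀ x : S₁.comap ψ₁, QuotientGroup.mk' N₁ x = 1 ↔ QuotientGroup.mk' N₂ (e x) = 1 := by
    intro x
    rw [QuotientGroup.mk'_apply, QuotientGroup.mk'_apply, QuotientGroup.eq_one_iff,
      QuotientGroup.eq_one_iff, hN₁, hN₂, apply_mem_commonKernel_iff]
  have hcomap₁ : ∀ W : Subgroup R₁, W.comap π₁ = (W.comap ψ₁).map (QuotientGroup.mk' N₁) :=
    fun W => by
      rw [← hπψ₁, ← Subgroup.comap_comap,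
        Subgroup.map_comap_eq_self_of_surjective (QuotientGroup.mk'_surjective N₁)]
  have hcomap₂ : ∀ W : Subgroup R₂, W.comap π₂ = (W.comap ψ₂).map (QuotientGroup.mk' N₂) :=
    fun W => by
      rw [← hπψ₂, ← Subgroup.comap_comap,
        Subgroup.map_comap_eq_self_of_surjective (QuotientGroup.mk'_surjective N₂)]
  refine ⟨_, _, _, _, ‹_›, ‹_›, π₁, π₂, hπ₁, hπ₂, ?_, ?_⟩
  · rw [hcomap₁, hcomap₂]
    exact nonempty_map_mulEquiv_map e hmk
  · rw [hcomap₁, hcomap₂]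
    exact nonempty_map_mulEquiv_map e' fun x => by
      rw [he' x]
      exact hmk (Subgroup.inclusion (Subgroup.comap_mono hT₁) x)

theorem HasPrimeNormalSeries.exists_common_cover {l : List ℕ} {R₁ R₂ : Type u} [Group R₁]
    [Group R₂] [Finite R₁] [Finite R₂] {T₁ : Subgroup R₁} {T₂ : Subgroup R₂}
    (h₁ : HasPrimeNormalSeries l T₁) (h₂ : HasPrimeNormalSeries l T₂) :
    ∃ (P : Type u) (_ : Group P) (_ : Finite P) (f₁ : P →* R₁) (f₂ : P →* R₂),
      T₁ ⊔ f₁.range = ⊤ ∧ T₂ ⊔ f₂.range = ⊤ ∧ Nonempty (T₁.comap f₁ ≃* T₂.comap f₂) := by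
  induction l generalizing R₁ R₂ with
  | nil =>
    cases h₁
    cases h₂
    exact ⟨PUnit, inferInstance, inferInstance, 1, 1, top_sup_eq _, top_sup_eq _, ⟨.refl _⟩⟩
  | cons p l ih =>
    cases h₁ with
    | cons hp hT₁ hTS₁ hindex₁ hS₁ =>
    cases h₂ with
    | cons _ hT₂ hTS₂ hindex₂ hS₂ =>
    have := hS₁.normal
    have := hS₂.normal
    obtain ⟨R₁', R₂', _, _, _, _, π₁, π₂, hπ₁, hπ₂, ⟨eS⟩, ⟨eT⟩⟩ :=
      exists_finite_covers_nonempty_comap_mulEquiv hTS₁ hTS₂ hp hindex₁ hindex₂ hS₁ hS₂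
    obtain ⟨P, _, _, f₁, f₂, hf₁, hf₂, ⟨φ⟩⟩ := ih (hS₁.comap hπ₁) (hS₂.comap hπ₂)
    obtain ⟨G, _, _, g₁, g₂, hg₁, hg₂, e⟩ := exists_surjective_nonempty_comap_mulEquiv hf₁ hf₂ φ
      (Subgroup.comap_mono hTS₁) (Subgroup.comap_mono hTS₂) eS eT
    have hπg₁ : (π₁.comp g₁).range = ⊤ := MonoidHom.range_eq_top.2 (hπ₁.comp hg₁)
    have hπg₂ : (π₂.comp g₂).range = ⊤ := MonoidHom.range_eq_top.2 (hπ₂.comp hg₂)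
    exact ⟨G, _, inferInstance, π₁.comp g₁, π₂.comp g₂, by rw [hπg₁, sup_top_eq],
      by rw [hπg₂, sup_top_eq], e⟩

theorem HasPrimeNormalSeries.groupsCompatible {l : List ℕ} {L₁ L₂ : Type} [Group L₁] [Group L₂]
    [Finite L₁] [Finite L₂] {N₁ : Subgroup L₁} {N₂ : Subgroup L₂}
    (h₁ : HasPrimeNormalSeries l N₁) (h₂ : HasPrimeNormalSeries l N₂) (e : N₁ ≃* N₂) :
    GroupsCompatible L₁ L₂ := by
  have := h₁.normal
  have := h₂.normal
  obtain ⟨P, _, _, f₁, f₂, hf₁, hf₂, ⟨φ⟩⟩ := h₁.exists_common_cover h₂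
  obtain ⟨G, _, _, g₁, g₂, hg₁, hg₂, hker⟩ := exists_surjective_nonempty_comap_mulEquiv hf₁ hf₂ φ
    (bot_le : ⊥ ≤ N₁) (bot_le : ⊥ ≤ N₂) e .ofUnique
  exact ⟨G, _, inferInstance, g₁.ker, g₂.ker, inferInstance, inferInstance, hker,
    ⟨(QuotientGroup.quotientKerEquivOfSurjective g₁ hg₁).symm⟩,
    ⟨(QuotientGroup.quotientKerEquivOfSurjective g₂ hg₂).symm⟩⟩

theorem GroupsCompatible.congr {L₁ L₂ L₁' L₂' : Type*} [Group L₁] [Group L₂] [Group L₁']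
    [Group L₂'] (e₁ : L₁ ≃* L₁') (e₂ : L₂ ≃* L₂') (h : GroupsCompatible L₁' L₂') :
    GroupsCompatible L₁ L₂ := by
  obtain ⟨G, _, hG, M₁, M₂, hM₁, hM₂, e, ⟨a₁⟩, ⟨a₂⟩⟩ := h
  exact ⟨G, _, hG, M₁, M₂, hM₁, hM₂, e, ⟨e₁.trans a₁⟩, ⟨e₂.trans a₂⟩⟩

theorem nonempty_comap_mulEquiv {G G' : Type*} [Group G] [Group G'] (s : G' ≃* G)
    (N : Subgroup G) : Nonempty (N.comap (s : G' →* G) ≃* N) :=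
  ⟨(s.subgroupMap _).trans
    (MulEquiv.subgroupCongr (Subgroup.map_comap_eq_self_of_surjective s.surjective N))⟩

/-! ### Nilpotent quotients -/

theorem inf_center_ne_bot_of_isNilpotent {G : Type*} [Group G] [Group.IsNilpotent G]
    {N : Subgroup G} [N.Normal] (hN : N ≠ ⊥) : N ⊓ Subgroup.center G ≠ ⊥ := by
  contrapose! hN
  have hcentral : ∀ k, N ⊓ Subgroup.upperCentralSeries G k = ⊥ := by
    intro k
    induction k with
    | zero => exact inf_bot_eq N
    | succ k ih =>
      refine (Subgroup.eq_bot_iff_forall _).2 fun x ⟨hxN, hx⟩ => ?_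
      have hcomm : ∀ g : G, x * g * x⁻¹ * g⁻¹ = 1 := fun g => by
        refine (Subgroup.eq_bot_iff_forall _).1 ih _ ⟨?_, hx g⟩
        rw [mul_assoc, mul_assoc, ← mul_assoc g]
        exact N.mul_mem hxN (Subgroup.Normal.conj_mem inferInstance _ (N.inv_mem hxN) g)
      refine (Subgroup.eq_bot_iff_forall _).1 hN x ⟨hxN, Subgroup.mem_center_iff.2 fun g => ?_⟩
      exact (mul_inv_eq_iff_eq_mul.1 (mul_inv_eq_one.1 (hcomm g))).symm
  obtain ⟨n, hn⟩ := Group.IsNilpotent.nilpotent G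
  simpa [hn] using hcentral n

theorem exists_mem_center_orderOf_eq_prime {G : Type*} [Group G] [Finite G] [Group.IsNilpotent G]
    {p : ℕ} (hp : p.Prime) (h : p ∣ Nat.card G) : ∃ z ∈ Subgroup.center G, orderOf z = p := by
  have : Fact p.Prime := ⟨hp⟩
  let Q : Sylow p G := default
  let C : Subgroup G := (Q : Subgroup G) ⊓ Subgroup.center G
  have hC : C ≠ ⊥ := inf_center_ne_bot_of_isNilpotent (Q.ne_bot_of_dvd_card h)
  have hCp : IsPGroup p C := Q.isPGroup'.to_le inf_le_left
  have hdvd : p ∣ Nat.card C := hCp.card_eq_or_dvd.resolve_left (mt Subgroup.card_eq_one.1 hC)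
  obtain ⟨z, hz⟩ := exists_prime_orderOf_dvd_card' p hdvd
  exact ⟨z, z.2.2, by rwa [Subgroup.orderOf_coe]⟩

theorem exists_normal_relIndex_eq_prime {R : Type*} [Group R] [Finite R] {T : Subgroup R}
    [T.Normal] [Group.IsNilpotent (R ⧸ T)] {p : ℕ} (hp : p.Prime) (h : p ∣ T.index) :
    ∃ (S : Subgroup R) (_ : S.Normal), T ≤ S ∧ T.relIndex S = p ∧ Group.IsNilpotent (R ⧸ S) := by
  obtain ⟨z, hz, hzp⟩ := exists_mem_center_orderOf_eq_prime (G := R ⧸ T) hp h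
  have : (Subgroup.zpowers z).Normal := ⟨fun y hy g => by
    have hyc : y ∈ Subgroup.center (R ⧸ T) := Subgroup.zpowers_le.2 hz hy
    rwa [Subgroup.mem_center_iff.1 hyc g, mul_inv_cancel_right]⟩
  have hT : (⊥ : Subgroup (R ⧸ T)).comap (QuotientGroup.mk' T) = T := QuotientGroup.ker_mk' T
  have hTS : T ≤ (Subgroup.zpowers z).comap (QuotientGroup.mk' T) :=
    hT.ge.trans (Subgroup.comap_mono bot_le)
  have hindex := relIndex_comap_comap (QuotientGroup.mk'_surjective T) ⊥ (Subgroup.zpowers z)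
  rw [hT, Subgroup.relIndex_bot_left, Nat.card_zpowers, hzp] at hindex
  exact ⟨_, inferInstance, hTS, hindex, Group.nilpotent_of_surjective
    (QuotientGroup.map T _ (MonoidHom.id R) hTS)
    (QuotientGroup.map_surjective_of_surjective _ _ _ (QuotientGroup.mk_surjective) _)⟩

theorem hasPrimeNormalSeries_of_isNilpotent_quotient {R : Type*} [Group R] [Finite R]
    {T : Subgroup R} [T.Normal] [Group.IsNilpotent (R ⧸ T)] {l : List ℕ}
    (hl : ∀ p ∈ l, p.Prime) (h : T.index = l.prod) : HasPrimeNormalSeries l T := by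
  induction l generalizing T with
  | nil =>
    obtain rfl := Subgroup.index_eq_one.1 h
    exact .nil
  | cons p l ih =>
    have hp : p.Prime := hl p List.mem_cons_self
    rw [List.prod_cons] at h
    obtain ⟨S, _, hTS, hindex, _⟩ := exists_normal_relIndex_eq_prime hp (Dvd.intro _ h.symm)
    have hS : S.index = l.prod := by
      refine Nat.eq_of_mul_eq_mul_left hp.pos ?_
      rw [← h, ← Subgroup.relIndex_mul_index hTS, hindex]
    exact .cons hp inferInstance hTS hindex (ih (fun q hq => hl q (List.mem_cons_of_mem p hq)) hS)

theorem hasPrimeNormalSeries_primeFactorsList_index {R : Type*} [Group R] [Finite R]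
    (T : Subgroup R) [T.Normal] [Group.IsNilpotent (R ⧸ T)] :
    HasPrimeNormalSeries T.index.primeFactorsList T :=
  hasPrimeNormalSeries_of_isNilpotent_quotient (fun _ => Nat.prime_of_mem_primeFactorsList)
    (Nat.prod_primeFactorsList Subgroup.index_ne_zero_of_finite).symm

theorem mainTheorem3_general {L₁ : Type*} {L₂ : Type*} [Group L₁] [Group L₂] [Finite L₁]
    [Finite L₂] {N₁ : Subgroup L₁} {N₂ : Subgroup L₂} {l : List ℕ}
    (h₁ : HasPrimeNormalSeries l N₁) (h₂ : HasPrimeNormalSeries l N₂)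
    (h : Nonempty (N₁ ≃* N₂)) : GroupsCompatible L₁ L₂ := by
  let s₁ : Shrink.{0} L₁ ≃* L₁ := Shrink.mulEquiv
  let s₂ : Shrink.{0} L₂ ≃* L₂ := Shrink.mulEquiv
  obtain ⟨e⟩ := h
  obtain ⟨e₁⟩ := nonempty_comap_mulEquiv s₁ N₁
  obtain ⟨e₂⟩ := nonempty_comap_mulEquiv s₂ N₂
  exact .congr s₁.symm s₂.symm ((h₁.comap s₁.surjective).groupsCompatible
    (h₂.comap s₂.surjective) ((e₁.trans e).trans e₂.symm))

theorem mainTheorem3 {L₁ : Type*} {L₂ : Type*} [Group L₁] [Group L₂] [Finite L₁] [Finite L₂]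
    (hcard : Nat.card L₁ = Nat.card L₂) :
    (∀ (N₁ : Subgroup L₁) (N₂ : Subgroup L₂) [N₁.Normal] [N₂.Normal],
      Nonempty (N₁ ≃* N₂) → Group.IsNilpotent (L₁ ⧸ N₁) → Group.IsNilpotent (L₂ ⧸ N₂) →
        GroupsCompatible L₁ L₂) ∧
    (Group.IsNilpotent L₁ → Group.IsNilpotent L₂ → GroupsCompatible L₁ L₂) := by
  have main : ∀ (N₁ : Subgroup L₁) (N₂ : Subgroup L₂) [N₁.Normal] [N₂.Normal],
      Nonempty (N₁ ≃* N₂) → Group.IsNilpotent (L₁ ⧸ N₁) → Group.IsNilpotent (L₂ ⧸ N₂) →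
        GroupsCompatible L₁ L₂ := fun N₁ N₂ _ _ e _ _ =>
    mainTheorem3_general (hasPrimeNormalSeries_primeFactorsList_index N₁)
      (index_eq_of_nonempty_mulEquiv hcard e ▸ hasPrimeNormalSeries_primeFactorsList_index N₂) e
  exact ⟨main, fun _ _ => main ⊥ ⊥ ⟨.ofUnique⟩ inferInstance inferInstance⟩
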